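/- For a real number $x$ and a positive integer $d$ let $G(x,d)$ be the number of pairs $(p,p')$ of primes with $p,p'\le x$ and $p'-p=d$. A positive integer $d$ is called a prime difference champion (PDC) for primes up to $x$ if $G(x,d)=\max_{e\ge 1}G(x,e)$, the maximum being taken over all positive integers $e$. For a positive integer $d$ put $M(d)=\sum_{p\mid d}\frac1p$, the sum running over the distinct primes dividing $d$, and for $x\ge 1$ put $M^*(x)=\max_{1\le d\le x}M(d)$, the maximum being over integers $d$. Then, unconditionally, for every choice of a PDC $d^*(x)$ for primes up to $x$ (for all sufficiently large real $x$), $$\sum_{p\mid d^*(x)}\frac1p\ \sim\ M^*(x)\ \sim\ \log\log\log x\qquad\text{as } x\to\infty .$$ -/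

import Mathlib

open Filter Asymptotics

namespace PrimeDifference

/-- `G x d` is the number of pairs `(p, p')` of primes with `p ≤ x`, `p' ≤ x` and `p' - p = d`. -/
noncomputable def G (x : ℝ) (d : ℕ) : ℕ :=
  ((Finset.Iic ⌊x⌋₊ ×ˢ Finset.Iic ⌊x⌋₊).filter
    fun q : ℕ × ℕ => q.1.Prime ∧ q.2.Prime ∧ q.1 + d = q.2).card

/-- `GStar x` is the maximum of `G x d` over the positive integers `d`. -/
noncomputable def GStar (x : ℝ) : ℕ :=
  sSup (G x '' {d : ℕ | 1 ≤ d})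

/-- `DStar x` is the set of prime difference champions for primes up to `x`: the positive
integers `d` at which `G x d` attains its maximum. -/
def DStar (x : ℝ) : Set ℕ :=
  {d : ℕ | 1 ≤ d ∧ G x d = GStar x}

/-- The sum of `1 / p` over the primes `p` dividing `d`. -/
noncomputable def M (d : ℕ) : ℝ :=
  ∑ p ∈ d.primeFactors, 1 / (p : ℝ)

/-- `MStar x` is the maximum of `M d` over the integers `1 ≤ d ≤ x`. -/
noncomputable def MStar (x : ℝ) : ℝ :=
  sSup (M '' {d : ℕ | 1 ≤ d ∧ (d : ℝ) ≤ x})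

/-- The supremum defining `GStar x` is an attained maximum. -/
theorem isGreatest_GStar (x : ℝ) : IsGreatest (G x '' {d : ℕ | 1 ≤ d}) (GStar x) := by
  have hne : (G x '' {d : ℕ | 1 ≤ d}).Nonempty := ⟨G x 1, 1, le_refl 1, rfl⟩
  have hbdd : BddAbove (G x '' {d : ℕ | 1 ≤ d}) := by
    refine ⟨(Finset.Iic ⌊x⌋₊ ×ˢ Finset.Iic ⌊x⌋₊).card, ?_⟩
    rintro _ ⟨d, -, rfl⟩
    exact Finset.card_filter_le _ _
  exact ⟨Nat.sSup_mem hne hbdd, fun _ h => le_csSup hbdd h⟩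

/-- A prime difference champion exists for every `x`. -/
theorem DStar_nonempty (x : ℝ) : (DStar x).Nonempty := by
  obtain ⟨d, hd, h⟩ := (isGreatest_GStar x).1
  exact ⟨d, hd, h⟩

/-- For `x ≥ 1` the supremum defining `MStar x` is an attained maximum. -/
theorem isGreatest_MStar {x : ℝ} (hx : 1 ≤ x) :
    IsGreatest (M '' {d : ℕ | 1 ≤ d ∧ (d : ℝ) ≤ x}) (MStar x) := by
  have hfin : {d : ℕ | 1 ≤ d ∧ (d : ℝ) ≤ x}.Finite :=
    (Set.finite_Iic ⌊x⌋₊).subset fun d hd => Nat.le_floor hd.2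
  have hne : (M '' {d : ℕ | 1 ≤ d ∧ (d : ℝ) ≤ x}).Nonempty :=
    ⟨M 1, 1, ⟨le_refl 1, by simpa using hx⟩, rfl⟩
  exact ⟨hne.csSup_mem (hfin.image M), fun _ h => le_csSup (hfin.image M).bddAbove h⟩

end PrimeDifference

namespace PrimeDifference

/-! Both quantities are squeezed between log log log x - C and (1 + δ) log log log x.

Upper bound: an integer d ≤ x has O(log x) prime factors, so those exceeding log x contribute O(1)
to M(d). The others contribute at most the sum of 1/p over p ≤ log x, which Mertens' second theorem
bounds (`M_le_sum_primes_add_two`, `eventually_sum_one_div_primes_le`).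

Lower bound: two estimates for G are compared at a champion d. Selberg's sieve gives G(x,d) ≪ x
exp(M(d)) / log² x for even d (`G_le_of_even`). Conversely, let q be the product of the primes up to
about (log x)/4. Primes not dividing q occupy only φ(q) classes mod q, so many pairs of them differ
by one of the at most x/q multiples of q; averaging gives max G ≫ (x / log² x) q/φ(q) ≫ x log log x
/ log² x (`eventually_GStar_ge`). Hence exp(M(d)) ≫ log log x. Only orders of magnitude matter: a
constant factor becomes an additive constant after taking logarithms. No conjecture on prime pairs
is needed. -/

/-! ### Truncated Euler products and the main sum of the sieve -/

/-- The sum of `∏ p ∈ S, g p` over the subsets `S` of `P` whose product is at most `y`. -/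
noncomputable def truncProd (g : ℕ → ℝ) (P : Finset ℕ) (y : ℝ) : ℝ :=
  ∑ S ∈ P.powerset with ((∏ p ∈ S, p : ℕ) : ℝ) ≤ y, ∏ p ∈ S, g p

theorem truncProd_mono {g : ℕ → ℝ} {P : Finset ℕ} (hg : ∀ p ∈ P, 0 ≤ g p) {y z : ℝ}
    (h : y ≤ z) : truncProd g P y ≤ truncProd g P z := by
  refine Finset.sum_le_sum_of_subset_of_nonneg
    (Finset.monotone_filter_right _ fun _ _ hS => le_trans hS h) fun _ hS _ => ?_
  exact Finset.prod_nonneg fun p hp =>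
    hg p (Finset.mem_powerset.1 (Finset.mem_filter.1 hS).1 hp)

theorem truncProd_nonneg {g : ℕ → ℝ} {P : Finset ℕ} (hg : ∀ p ∈ P, 0 ≤ g p) (y : ℝ) :
    0 ≤ truncProd g P y :=
  Finset.sum_nonneg fun _ hS => Finset.prod_nonneg fun p hp =>
    hg p (Finset.mem_powerset.1 (Finset.mem_filter.1 hS).1 hp)

theorem truncProd_pos {g : ℕ → ℝ} {P : Finset ℕ} (hg : ∀ p ∈ P, 0 ≤ g p) {y : ℝ} (hy : 1 ≤ y) :
    0 < truncProd g P y := by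
  have h : ∏ p ∈ (∅ : Finset ℕ), g p ≤ truncProd g P y := by
    refine Finset.single_le_sum (f := fun S => ∏ p ∈ S, g p) (fun S hS => ?_) ?_
    · exact Finset.prod_nonneg fun p hp =>
        hg p (Finset.mem_powerset.1 (Finset.mem_filter.1 hS).1 hp)
    · simpa using hy
  simp only [Finset.prod_empty] at h
  linarith

theorem truncProd_le_prod {g : ℕ → ℝ} {P : Finset ℕ} (hg : ∀ p ∈ P, 0 ≤ g p) (y : ℝ) :
    truncProd g P y ≤ ∏ p ∈ P, (1 + g p) := by
  rw [Finset.prod_one_add]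
  exact Finset.sum_le_sum_of_subset_of_nonneg (Finset.filter_subset _ _) fun S hS _ =>
    Finset.prod_nonneg fun p hp => hg p (Finset.mem_powerset.1 hS hp)

/-- Subsets are split by whether they contain p; those that do have a bound y / p left for the rest.
-/
theorem truncProd_insert (g : ℕ → ℝ) {P : Finset ℕ} {p : ℕ} (hp : p ∉ P) (hp0 : 0 < p) (y : ℝ) :
    truncProd g (insert p P) y = truncProd g P y + g p * truncProd g P (y / p) := by
  unfold truncProd
  simp only [Finset.sum_filter]
  rw [Finset.sum_powerset_insert hp, Finset.mul_sum]
  congr 1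
  refine Finset.sum_congr rfl fun S hS => ?_
  have hpS : p ∉ S := fun h => hp (Finset.mem_powerset.1 hS h)
  have hpos : (0 : ℝ) < p := by exact_mod_cast hp0
  simp only [Finset.prod_insert hpS, le_div_iff₀ hpos, Nat.cast_mul, mul_comm (p : ℝ), mul_ite,
    mul_zero]

/-- The number of roots of `n (n + d)` modulo the prime `p`. -/
def rootCount (d p : ℕ) : ℕ := if p ∣ d then 1 else 2

/-- The sieve weight `ρ(p) / (p - ρ(p))` attached to `n (n + d)`. -/
noncomputable def sieveWeight (d p : ℕ) : ℝ := rootCount d p / (p - rootCount d p)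

theorem rootCount_lt {d p : ℕ} (hd : 2 ∣ d) (hp : p.Prime) : rootCount d p < p := by
  unfold rootCount
  split_ifs with h
  · exact hp.one_lt
  · exact lt_of_le_of_ne hp.two_le fun h2 => h (h2 ▸ hd)

theorem rootCount_pos (d p : ℕ) : 0 < rootCount d p := by
  unfold rootCount
  split_ifs <;> norm_num

theorem sieveWeight_pos {d p : ℕ} (hd : 2 ∣ d) (hp : p.Prime) : 0 < sieveWeight d p := by
  have h1 : (0 : ℝ) < rootCount d p := by exact_mod_cast rootCount_pos d p
  have h2 : (rootCount d p : ℝ) < p := by exact_mod_cast rootCount_lt hd hp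
  exact div_pos h1 (by linarith)

/-- Bounds the Selberg sum from below by two copies of ∑ 1/m. Locally (1 + 1/p)² is compared with 1
+ `sieveWeight d p`: for p ∤ d the weight 2/(p - 2) suffices, while for p ∣ d the weight 1/(p - 1)
only pays for one factor 1 + 1/p and the other goes into the product over p ∣ d. Induction on the
set of primes keeps track of the truncation. -/
theorem truncProd_mul_truncProd_le {d : ℕ} (hd : 2 ∣ d) (P : Finset ℕ) (hP : ∀ p ∈ P, p.Prime) :
    ∀ y z : ℝ, 0 ≤ y → 0 ≤ z →
      truncProd (fun p => 1 / (p : ℝ)) P y * truncProd (fun p => 1 / (p : ℝ)) P z ≤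
        truncProd (sieveWeight d) P (y * z) * ∏ p ∈ P with p ∣ d, (1 + 1 / (p : ℝ)) := by
  induction P using Finset.induction_on with
  | empty =>
    intro y z hy hz
    have key : ∀ (g : ℕ → ℝ) (y : ℝ), truncProd g ∅ y = if 1 ≤ y then 1 else 0 := by
      intro g y
      simp only [truncProd, Finset.sum_filter, Finset.powerset_empty, Finset.sum_singleton,
        Finset.prod_empty, Nat.cast_one]
    simp only [key, Finset.filter_empty, Finset.prod_empty, mul_one]
    split_ifs with h1 h2 h3
    all_goals norm_num
    nlinarith
  | insert p P hpP ih =>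
    intro y z hy hz
    have hp : p.Prime := hP p (Finset.mem_insert_self _ _)
    have hP' : ∀ p ∈ P, p.Prime := fun q hq => hP q (Finset.mem_insert_of_mem hq)
    have ih := ih hP'
    have hp2 : (2 : ℝ) ≤ p := by exact_mod_cast hp.two_le
    have hp0 : (0 : ℝ) < p := by linarith
    rw [truncProd_insert _ hpP hp.pos, truncProd_insert _ hpP hp.pos,
      truncProd_insert _ hpP hp.pos]
    set F := truncProd (fun p => 1 / (p : ℝ)) P with hF
    set H := truncProd (sieveWeight d) P with hH
    have hHm : Monotone H := fun a b h =>
      truncProd_mono (fun q hq => (sieveWeight_pos hd (hP' q hq)).le) h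
    have hH0 : ∀ a, 0 ≤ H a := fun a =>
      truncProd_nonneg (fun q hq => (sieveWeight_pos hd (hP' q hq)).le) a
    set E := ∏ p ∈ P with p ∣ d, (1 + 1 / (p : ℝ)) with hE
    have hE0 : 0 ≤ E := Finset.prod_nonneg fun q _ => by positivity
    have i1 := ih y z hy hz
    have i2 := ih (y / p) z (by positivity) hz
    have i3 := ih y (z / p) hy (by positivity)
    have i4 := ih (y / p) (z / p) (by positivity) (by positivity)
    rw [div_mul_eq_mul_div] at i2
    rw [mul_div_assoc'] at i3
    have hyz : 0 ≤ y * z := by positivity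
    -- When both factors use p, the combined set uses it only once, so the bound y z / p is enough.
    have m1 : H (y / p * (z / p)) ≤ H (y * z / p) := by
      apply hHm
      rw [div_mul_div_comm]
      apply div_le_div_of_nonneg_left hyz hp0
      nlinarith
    have m2 : H (y * z / p) ≤ H (y * z) := hHm (div_le_self hyz (by linarith))
    have u0 : (0 : ℝ) ≤ 1 / p := by positivity
    have expand : (F y + 1 / p * F (y / p)) * (F z + 1 / p * F (z / p)) ≤
        (H (y * z) + 2 * (1 / p) * H (y * z / p) + (1 / p) * (1 / p) * H (y * z / p)) * E := by
      have i4' := i4.trans (mul_le_mul_of_nonneg_right m1 hE0)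
      have j2 := mul_le_mul_of_nonneg_left i2 u0
      have j3 := mul_le_mul_of_nonneg_left i3 u0
      have j4 := mul_le_mul_of_nonneg_left i4' (mul_nonneg u0 u0)
      linarith
    refine expand.trans ?_
    by_cases hpd : p ∣ d
    · have hg : sieveWeight d p = 1 / ((p : ℝ) - 1) := by simp [sieveWeight, rootCount, hpd]
      have hg' : 1 / (p : ℝ) ≤ sieveWeight d p := by
        rw [hg]; exact one_div_le_one_div_of_le (by linarith) (by linarith)
      rw [Finset.filter_insert, if_pos hpd, Finset.prod_insert (by simp [hpP]), ← hE, ← mul_assoc]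
      refine mul_le_mul_of_nonneg_right ?_ hE0
      have h1 := mul_le_mul_of_nonneg_right hg' (hH0 (y * z / p))
      have h2 := mul_le_mul_of_nonneg_left m2 u0
      have h3 := mul_le_mul_of_nonneg_left h1 u0
      linarith
    · have hp3 : (3 : ℝ) ≤ p := by
        have : p ≠ 2 := fun h => hpd (h ▸ hd)
        have := hp.two_le
        exact_mod_cast (by omega : 3 ≤ p)
      have hg : sieveWeight d p = 2 / ((p : ℝ) - 2) := by simp [sieveWeight, rootCount, hpd]
      have hg' : 2 * (1 / (p : ℝ)) + 1 / p * (1 / p) ≤ sieveWeight d p := by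
        have h2 : (0 : ℝ) < (p : ℝ) - 2 := by linarith
        rw [hg, le_div_iff₀ h2]
        field_simp
        nlinarith
      rw [Finset.filter_insert, if_neg hpd, ← hE]
      refine mul_le_mul_of_nonneg_right ?_ hE0
      have h1 := mul_le_mul_of_nonneg_right hg' (hH0 (y * z / p))
      linarith

theorem sum_one_div_sq_le (n : ℕ) : ∑ b ∈ Finset.Icc 1 n, 1 / (b : ℝ) ^ 2 ≤ 2 := by
  have h : ∀ n : ℕ, ∑ b ∈ Finset.Icc 1 (n + 1), 1 / (b : ℝ) ^ 2 ≤ 2 - 1 / ((n : ℝ) + 1) := by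
    intro n
    induction n with
    | zero => norm_num
    | succ n ih =>
      rw [Finset.sum_Icc_succ_top (by omega)]
      refine (add_le_add_left ih _).trans ?_
      push_cast
      have h1 : (0 : ℝ) < n + 1 := by positivity
      -- Telescoping.
      have h2 : 1 / ((n : ℝ) + 1 + 1) ^ 2 ≤ 1 / (n + 1) - 1 / (n + 1 + 1) := by
        rw [div_sub_div _ _ (by positivity) (by positivity)]
        apply div_le_div₀ (by linarith) (by linarith) (by positivity)
        nlinarith
      linarith
  rcases n with _ | n
  · norm_num
  · have := h n
    have h1 : (0 : ℝ) ≤ 1 / ((n : ℝ) + 1) := by positivity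
    linarith

/-- Every k ≤ n is a b² with a squarefree, so the harmonic sum is at most the squarefree sum times ∑
1/b² ≤ 2. -/
theorem log_le_two_mul_truncProd (n : ℕ) :
    Real.log n ≤ 2 * truncProd (fun p => 1 / (p : ℝ)) (Nat.primesLE n) n := by
  rcases Nat.eq_zero_or_pos n with rfl | hn
  · simpa using truncProd_nonneg (fun p _ => by positivity) _
  have h1 : Real.log n ≤ ∑ k ∈ Finset.Icc 1 n, 1 / (k : ℝ) := by
    have := log_add_one_le_harmonic n
    rw [harmonic_eq_sum_Icc] at this
    push_cast at this
    simp only [one_div]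
    refine le_trans (Real.log_le_log (by exact_mod_cast hn) ?_) this
    linarith
  set D := (Nat.primesLE n).powerset.filter fun S => ((∏ p ∈ S, p : ℕ) : ℝ) ≤ n with hD
  set f : Finset ℕ × ℕ → ℕ := fun c => (∏ p ∈ c.1, p) * c.2 ^ 2 with hf
  have hsub : Finset.Icc 1 n ⊆ (D ×ˢ Finset.Icc 1 n).image f := by
    intro k hk
    rw [Finset.mem_Icc] at hk
    obtain ⟨a, b, ha, hb, hab, hsq⟩ := Nat.sq_mul_squarefree_of_pos (n := k) (by omega)
    have hbn : b ≤ n := by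
      have : b ≤ b ^ 2 * a := by nlinarith [Nat.mul_le_mul hb ha, Nat.mul_le_mul hb hb]
      omega
    have han : a ≤ n := by
      have : 1 ≤ b ^ 2 := Nat.one_le_pow _ _ hb
      nlinarith
    rw [Finset.mem_image]
    refine ⟨(a.primeFactors, b), ?_, ?_⟩
    · simp only [Finset.mem_product, hD, Finset.mem_filter, Finset.mem_powerset, Finset.mem_Icc,
        Nat.prod_primeFactors_of_squarefree hsq]
      refine ⟨⟨fun p hp => ?_, by exact_mod_cast han⟩, hb, hbn⟩
      rw [Nat.mem_primesLE]
      exact ⟨(Nat.le_of_mem_primeFactors hp).trans han, Nat.prime_of_mem_primeFactors hp⟩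
    · simp only [hf, Nat.prod_primeFactors_of_squarefree hsq]
      rw [mul_comm, hab]
  have h2 : ∑ k ∈ Finset.Icc 1 n, 1 / (k : ℝ) ≤
      ∑ c ∈ D ×ˢ Finset.Icc 1 n, 1 / (f c : ℝ) := by
    refine (Finset.sum_le_sum_of_subset_of_nonneg hsub fun _ _ _ => by positivity).trans ?_
    exact Finset.sum_image_le_of_nonneg (fun _ _ => by positivity)
  have h3 : ∑ c ∈ D ×ˢ Finset.Icc 1 n, 1 / (f c : ℝ) =
      truncProd (fun p => 1 / (p : ℝ)) (Nat.primesLE n) n *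
        ∑ b ∈ Finset.Icc 1 n, 1 / (b : ℝ) ^ 2 := by
    rw [truncProd, ← hD, Finset.sum_mul_sum, Finset.sum_product]
    refine Finset.sum_congr rfl fun S _ => Finset.sum_congr rfl fun b _ => ?_
    simp only [hf]
    push_cast
    rw [Finset.prod_div_distrib, Finset.prod_const_one, div_mul_div_comm, one_mul]
  have h4 := mul_le_mul_of_nonneg_left (sum_one_div_sq_le n)
    (truncProd_nonneg (g := fun p => 1 / (p : ℝ)) (P := Nat.primesLE n)
      (fun p _ => by positivity) n)
  linarith

/-! ### Periodic functions and Selberg's sieve -/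

/-- Chinese remainder theorem: n ↦ (n mod a, n mod b) is a bijection onto pairs of residues. -/
theorem sum_range_mul_of_coprime {a b : ℕ} (ha : 0 < a) (hb : 0 < b) (hab : a.Coprime b)
    {f g : ℕ → ℝ} (hf : Function.Periodic f a) (hg : Function.Periodic g b) :
    ∑ n ∈ Finset.range (a * b), f n * g n =
      (∑ n ∈ Finset.range a, f n) * ∑ n ∈ Finset.range b, g n := by
  rw [Finset.sum_mul_sum, ← Finset.sum_product']
  refine Finset.sum_bij (fun n _ => (n % a, n % b)) ?_ ?_ ?_ ?_
  · intro n _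
    simp [Nat.mod_lt _ ha, Nat.mod_lt _ hb]
  · intro m hm n hn h
    rw [Finset.mem_range] at hm hn
    rw [Prod.mk.injEq] at h
    exact Nat.ModEq.eq_of_lt_of_lt ((Nat.modEq_and_modEq_iff_modEq_mul hab).1 h) hm hn
  · rintro ⟨u, v⟩ huv
    rw [Finset.mem_product, Finset.mem_range, Finset.mem_range] at huv
    refine ⟨Nat.chineseRemainder hab u v, ?_, ?_⟩
    · rw [Finset.mem_range]
      exact Nat.chineseRemainder_lt_mul hab u v ha.ne' hb.ne'
    · have h := (Nat.chineseRemainder hab u v).2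
      rw [Prod.mk.injEq]
      exact ⟨Eq.trans h.1 (Nat.mod_eq_of_lt huv.1), Eq.trans h.2 (Nat.mod_eq_of_lt huv.2)⟩
  · intro n _
    simp only [hf.map_mod_nat, hg.map_mod_nat]

theorem periodic_prod {S : Finset ℕ} {h : ℕ → ℕ → ℝ}
    (hh : ∀ p ∈ S, Function.Periodic (h p) p) :
    Function.Periodic (fun n => ∏ p ∈ S, h p n) (∏ p ∈ S, p) := by
  intro n
  refine Finset.prod_congr rfl fun p hp => ?_
  obtain ⟨k, hk⟩ := Finset.dvd_prod_of_mem (fun p : ℕ => p) hp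
  have := (hh p hp).nat_mul k n
  rw [hk, mul_comm]
  simpa using this

theorem sum_range_prod_of_periodic {S : Finset ℕ} (hS : ∀ p ∈ S, p.Prime) {h : ℕ → ℕ → ℝ}
    (hh : ∀ p ∈ S, Function.Periodic (h p) p) :
    ∑ n ∈ Finset.range (∏ p ∈ S, p), ∏ p ∈ S, h p n =
      ∏ p ∈ S, ∑ n ∈ Finset.range p, h p n := by
  induction S using Finset.induction_on with
  | empty => simp
  | insert q S hq ih =>
    have hS' : ∀ p ∈ S, p.Prime := fun p hp => hS p (Finset.mem_insert_of_mem hp)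
    have hh' : ∀ p ∈ S, Function.Periodic (h p) p := fun p hp => hh p (Finset.mem_insert_of_mem hp)
    have hqp := hS q (Finset.mem_insert_self _ _)
    simp only [Finset.prod_insert hq]
    rw [sum_range_mul_of_coprime hqp.pos (Finset.prod_pos fun p hp => (hS' p hp).pos) ?_
      (hh q (Finset.mem_insert_self _ _)) (periodic_prod hh'), ih hS' hh']
    refine Nat.Coprime.prod_right fun p hp => (Nat.coprime_primes hqp (hS' p hp)).2 ?_
    rintro rfl
    exact hq hp

/-- Complete periods plus a remainder of fewer than Q terms. Nonnegativity of the period sum allows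
⌊N/Q⌋ to be replaced by N/Q. -/
theorem sum_range_le_of_periodic {Q : ℕ} (hQ : 0 < Q) {f : ℕ → ℝ} (hf : Function.Periodic f Q)
    {B : ℝ} (hB0 : 0 ≤ B) (hB : ∀ n, f n ≤ B) (hs : 0 ≤ ∑ n ∈ Finset.range Q, f n) (N : ℕ) :
    ∑ n ∈ Finset.range N, f n ≤ (N : ℝ) / Q * (∑ n ∈ Finset.range Q, f n) + Q * B := by
  have hmul : ∀ k : ℕ, ∑ n ∈ Finset.range (Q * k), f n = k * ∑ n ∈ Finset.range Q, f n := by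
    intro k
    induction k with
    | zero => simp
    | succ k ih =>
      rw [Nat.mul_succ, Finset.sum_range_add, ih]
      have : ∀ n, f (Q * k + n) = f n := fun n => by
        have := hf.nat_mul k n
        rw [← this]
        congr 1
        simp [mul_comm, add_comm]
      simp only [this]
      push_cast
      ring
  have hN := Nat.div_add_mod N Q
  conv_lhs => rw [← hN]
  rw [Finset.sum_range_add, hmul]
  have h1 : ((N / Q : ℕ) : ℝ) ≤ (N : ℝ) / Q := Nat.cast_div_le
  have h2 : ∑ n ∈ Finset.range (N % Q), f (Q * (N / Q) + n) ≤ Q * B := by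
    refine (Finset.sum_le_card_nsmul _ _ B fun n _ => hB _).trans ?_
    rw [Finset.card_range, nsmul_eq_mul]
    have : ((N % Q : ℕ) : ℝ) ≤ Q := by exact_mod_cast (Nat.mod_lt N hQ).le
    exact mul_le_mul_of_nonneg_right this hB0
  have h3 := mul_le_mul_of_nonneg_right h1 hs
  linarith

/-- Quasi-orthogonality of the functions `∏ p ∈ S, ψ p n`. -/
theorem sum_range_prod_mul_prod_le {P : Finset ℕ} (hP : ∀ p ∈ P, p.Prime) {ψ : ℕ → ℕ → ℝ}
    {g : ℕ → ℝ} (hg : ∀ p ∈ P, 0 < g p) (hper : ∀ p ∈ P, Function.Periodic (ψ p) p)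
    (hsum : ∀ p ∈ P, ∑ n ∈ Finset.range p, ψ p n = 0)
    (hsq : ∀ p ∈ P, ∑ n ∈ Finset.range p, ψ p n ^ 2 = p / g p)
    (hle : ∀ p ∈ P, ∀ n, |ψ p n| ≤ p) {z : ℝ} {S T : Finset ℕ} (hS : S ⊆ P) (hT : T ⊆ P)
    (hSz : ((∏ p ∈ S, p : ℕ) : ℝ) ≤ z) (hTz : ((∏ p ∈ T, p : ℕ) : ℝ) ≤ z) (N : ℕ) :
    ∑ n ∈ Finset.range N, (∏ p ∈ S, ψ p n) * ∏ p ∈ T, ψ p n ≤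
      (if S = T then N / ∏ p ∈ S, g p else 0) + z ^ 4 := by
  classical
  -- Padding with factors 1 turns the product of the two functions into a single product over S ∪ T
  -- of p-periodic functions.
  set h : ℕ → ℕ → ℝ := fun p n => (if p ∈ S then ψ p n else 1) * (if p ∈ T then ψ p n else 1)
    with hh
  have hST : S ∪ T ⊆ P := Finset.union_subset hS hT
  have hprod : ∀ n, ∏ p ∈ S ∪ T, h p n = (∏ p ∈ S, ψ p n) * ∏ p ∈ T, ψ p n := by
    intro n
    simp only [hh]
    rw [Finset.prod_mul_distrib, Finset.prod_ite_mem, Finset.prod_ite_mem,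
      Finset.union_inter_cancel_left, Finset.union_inter_cancel_right]
  have hperh : ∀ p ∈ S ∪ T, Function.Periodic (h p) p := fun p hp n => by
    simp only [hh, hper p (hST hp) n]
  have hQpos : 0 < ∏ p ∈ S ∪ T, p := Finset.prod_pos fun p hp => (hP p (hST hp)).pos
  have hz1 : 1 ≤ z := by
    refine le_trans ?_ hSz
    exact_mod_cast Nat.one_le_iff_ne_zero.2 (Finset.prod_pos fun p hp => (hP p (hS hp)).pos).ne'
  have hQ : ((∏ p ∈ S ∪ T, p : ℕ) : ℝ) ≤ z ^ 2 := by
    have h1 : ∏ p ∈ S ∪ T, p ≤ (∏ p ∈ S, p) * ∏ p ∈ T, p := by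
      rw [← Finset.prod_union_inter]
      exact Nat.le_mul_of_pos_right _ (Finset.prod_pos fun p hp =>
        (hP p (hS (Finset.mem_of_mem_inter_left hp))).pos)
    calc ((∏ p ∈ S ∪ T, p : ℕ) : ℝ) ≤ ((∏ p ∈ S, p : ℕ) : ℝ) * ((∏ p ∈ T, p : ℕ) : ℝ) := by
          exact_mod_cast h1
      _ ≤ z * z := by gcongr
      _ = z ^ 2 := by ring
  have hbound : ∀ U ⊆ P, ((∏ p ∈ U, p : ℕ) : ℝ) ≤ z → ∀ n, |∏ p ∈ U, ψ p n| ≤ z := by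
    intro U hU hUz n
    rw [Finset.abs_prod]
    refine le_trans ?_ hUz
    rw [Nat.cast_prod]
    exact Finset.prod_le_prod (fun _ _ => abs_nonneg _) fun p hp => hle p (hU hp) n
  have hB : ∀ n, ∏ p ∈ S ∪ T, h p n ≤ z ^ 2 := by
    intro n
    rw [hprod]
    refine (le_abs_self _).trans ?_
    rw [abs_mul, sq]
    exact mul_le_mul (hbound S hS hSz n) (hbound T hT hTz n) (abs_nonneg _) (by linarith)
  have hper_sum : ∑ n ∈ Finset.range (∏ p ∈ S ∪ T, p), ∏ p ∈ S ∪ T, h p n =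
      if S = T then ((∏ p ∈ S ∪ T, p : ℕ) : ℝ) / ∏ p ∈ S, g p else 0 := by
    rw [sum_range_prod_of_periodic (fun p hp => hP p (hST hp)) hperh]
    split_ifs with hEq
    · subst hEq
      rw [Finset.union_self, Nat.cast_prod, ← Finset.prod_div_distrib]
      refine Finset.prod_congr rfl fun p hp => ?_
      rw [← hsq p (hS hp)]
      refine Finset.sum_congr rfl fun n _ => ?_
      simp only [hh, if_pos hp, sq]
    -- A prime lying in exactly one of S and T contributes a lone ψ p, whose sum over a period
    -- vanishes.
    · have : ∃ p ∈ S ∪ T, ¬ (p ∈ S ↔ p ∈ T) := by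
        by_contra hcon
        push Not at hcon
        apply hEq
        ext p
        by_cases hp : p ∈ S ∪ T
        · exact hcon p hp
        · rw [Finset.mem_union, not_or] at hp
          simp [hp.1, hp.2]
      obtain ⟨p, hp, hpne⟩ := this
      refine Finset.prod_eq_zero hp ?_
      rw [← hsum p (hST hp)]
      refine Finset.sum_congr rfl fun n _ => ?_
      simp only [hh]
      by_cases h1 : p ∈ S <;> by_cases h2 : p ∈ T <;> simp [h1, h2] at hpne ⊢
  have hgpos : 0 < ∏ p ∈ S, g p := Finset.prod_pos fun p hp => hg p (hS hp)
  have hnn : 0 ≤ ∑ n ∈ Finset.range (∏ p ∈ S ∪ T, p), ∏ p ∈ S ∪ T, h p n := by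
    rw [hper_sum]
    split_ifs
    · positivity
    · exact le_rfl
  have main := sum_range_le_of_periodic hQpos (periodic_prod hperh) (by positivity) hB hnn N
  simp only [hprod] at main hper_sum
  refine main.trans ?_
  have hQpos' : (0 : ℝ) < ((∏ p ∈ S ∪ T, p : ℕ) : ℝ) := by exact_mod_cast hQpos
  -- The period and the sup norm are each at most z².
  have e1 : ((∏ p ∈ S ∪ T, p : ℕ) : ℝ) * z ^ 2 ≤ z ^ 4 := by
    calc _ ≤ z ^ 2 * z ^ 2 := by gcongr
      _ = z ^ 4 := by ring
  rw [hper_sum]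
  refine add_le_add ?_ e1
  split_ifs
  · apply le_of_eq
    field_simp
  · simp

/-- Selberg's upper bound sieve. -/
theorem card_sifted_mul_truncProd_le {P : Finset ℕ} (hP : ∀ p ∈ P, p.Prime) {ψ : ℕ → ℕ → ℝ}
    {g : ℕ → ℝ} (hg : ∀ p ∈ P, 0 < g p) (hper : ∀ p ∈ P, Function.Periodic (ψ p) p)
    (hsum : ∀ p ∈ P, ∑ n ∈ Finset.range p, ψ p n = 0)
    (hsq : ∀ p ∈ P, ∑ n ∈ Finset.range p, ψ p n ^ 2 = p / g p)
    (hle : ∀ p ∈ P, ∀ n, |ψ p n| ≤ p) {z : ℝ} (hz : 1 ≤ z) (N : ℕ) {A : Finset ℕ}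
    (hA : A ⊆ Finset.range N) (hA1 : ∀ n ∈ A, ∀ p ∈ P, ψ p n = 1) :
    (A.card : ℝ) * truncProd g P z ≤ N + z ^ 4 * truncProd g P z := by
  classical
  set J := truncProd g P z with hJ
  have hJpos : 0 < J := truncProd_pos (fun p hp => (hg p hp).le) hz
  set D := P.powerset.filter fun S => ((∏ p ∈ S, p : ℕ) : ℝ) ≤ z with hD
  have hDP : ∀ S ∈ D, S ⊆ P ∧ ((∏ p ∈ S, p : ℕ) : ℝ) ≤ z := fun S hS => by
    rw [hD, Finset.mem_filter, Finset.mem_powerset] at hS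
    exact hS
  have hJD : J = ∑ S ∈ D, ∏ p ∈ S, g p := rfl
  have hGpos : ∀ S ∈ D, 0 < ∏ p ∈ S, g p := fun S hS =>
    Finset.prod_pos fun p hp => hg p ((hDP S hS).1 hp)
  -- The weight equals J on the sifted set, while by quasi-orthogonality its mean square is about J;
  -- comparing ∑ w² over A and over all n < N gives the sieve bound.
  set w : ℕ → ℝ := fun n => ∑ S ∈ D, (∏ p ∈ S, g p) * ∏ p ∈ S, ψ p n with hw
  have hwA : ∀ n ∈ A, w n = J := fun n hn => by
    rw [hw, hJD]
    refine Finset.sum_congr rfl fun S hS => ?_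
    rw [Finset.prod_eq_one fun p hp => hA1 n hn p ((hDP S hS).1 hp), mul_one]
  have h1 : (A.card : ℝ) * J ^ 2 ≤ ∑ n ∈ Finset.range N, w n ^ 2 := by
    calc (A.card : ℝ) * J ^ 2 = ∑ n ∈ A, w n ^ 2 := by
          rw [Finset.sum_congr rfl fun n hn => by rw [hwA n hn], Finset.sum_const, nsmul_eq_mul]
      _ ≤ _ := Finset.sum_le_sum_of_subset_of_nonneg hA fun _ _ _ => sq_nonneg _
  have h2 : ∑ n ∈ Finset.range N, w n ^ 2 = ∑ S ∈ D, ∑ T ∈ D, (∏ p ∈ S, g p) * (∏ p ∈ T, g p) *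
      ∑ n ∈ Finset.range N, (∏ p ∈ S, ψ p n) * ∏ p ∈ T, ψ p n := by
    simp only [hw, sq, Finset.sum_mul_sum]
    rw [Finset.sum_comm]
    refine Finset.sum_congr rfl fun S _ => ?_
    rw [Finset.sum_comm]
    refine Finset.sum_congr rfl fun T _ => ?_
    rw [Finset.mul_sum]
    refine Finset.sum_congr rfl fun n _ => ?_
    ring
  have h3 : ∑ n ∈ Finset.range N, w n ^ 2 ≤ ∑ S ∈ D, ∑ T ∈ D, (∏ p ∈ S, g p) * (∏ p ∈ T, g p) *
      ((if S = T then N / ∏ p ∈ S, g p else 0) + z ^ 4) := by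
    rw [h2]
    refine Finset.sum_le_sum fun S hS => Finset.sum_le_sum fun T hT => ?_
    exact mul_le_mul_of_nonneg_left (sum_range_prod_mul_prod_le hP hg hper hsum hsq hle
      (hDP S hS).1 (hDP T hT).1 (hDP S hS).2 (hDP T hT).2 N)
      (mul_pos (hGpos S hS) (hGpos T hT)).le
  have h4 : ∑ S ∈ D, ∑ T ∈ D, (∏ p ∈ S, g p) * (∏ p ∈ T, g p) *
      ((if S = T then N / ∏ p ∈ S, g p else 0) + z ^ 4) = N * J + z ^ 4 * J ^ 2 := by
    simp only [mul_add, Finset.sum_add_distrib]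
    congr 1
    · rw [hJD, Finset.mul_sum]
      refine Finset.sum_congr rfl fun S hS => ?_
      simp only [mul_ite, mul_zero]
      rw [Finset.sum_ite_eq, if_pos hS]
      have := (hGpos S hS).ne'
      field_simp
    · simp only [← Finset.sum_mul, ← Finset.sum_mul_sum]
      rw [← hJD]
      ring
  rw [h4] at h3
  have h5 : ((A.card : ℝ) * J) * J ≤ (N + z ^ 4 * J) * J := by linarith
  exact le_of_mul_le_mul_right h5 hJpos

/-! ### Local data of n (n + d) -/

theorem card_filter_range_dvd_mul_add {d p : ℕ} (hp : p.Prime) :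
    ((Finset.range p).filter fun n => p ∣ n * (n + d)).card = rootCount d p := by
  have hpos := hp.pos
  -- The roots are 0 and -d; the outer `% p` makes them coincide when p ∣ d.
  have hset : ((Finset.range p).filter fun n => p ∣ n * (n + d)) = {0, (p - d % p) % p} := by
    ext n
    simp only [Finset.mem_filter, Finset.mem_range, Finset.mem_insert, Finset.mem_singleton]
    have hdp := Nat.mod_lt d hpos
    constructor
    · rintro ⟨hn, h⟩
      rcases (hp.dvd_mul).1 h with h | h
      · exact Or.inl (Nat.eq_zero_of_dvd_of_lt h hn)
      · right
        have h' : p ∣ n + d % p := by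
          rwa [Nat.dvd_iff_mod_eq_zero, Nat.add_mod_mod, ← Nat.dvd_iff_mod_eq_zero]
        obtain ⟨k, hk⟩ := h'
        have hk2 : k < 2 := by
          by_contra hcon
          have : p * 2 ≤ p * k := Nat.mul_le_mul_left p (by omega)
          omega
        interval_cases k
        · have h0 : d % p = 0 := by omega
          have hn0 : n = 0 := by omega
          simp [h0, hn0]
        · rcases Nat.eq_zero_or_pos (d % p) with h0 | h0
          · omega
          · rw [Nat.mod_eq_of_lt (by omega)]
            omega
    · rintro (rfl | rfl)
      · exact ⟨hpos, by simp⟩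
      · refine ⟨Nat.mod_lt _ hpos, Dvd.dvd.mul_left ?_ _⟩
        rw [Nat.dvd_iff_mod_eq_zero, Nat.mod_add_mod, ← Nat.add_mod_mod,
          Nat.sub_add_cancel hdp.le, Nat.mod_self]
  rw [hset, rootCount]
  split_ifs with h
  · rw [Nat.mod_eq_zero_of_dvd h]
    simp
  · rw [Finset.card_pair]
    have h0 : 0 < d % p := Nat.pos_of_ne_zero fun h0 => h (Nat.dvd_of_mod_eq_zero h0)
    have hdp := Nat.mod_lt d hpos
    rw [Nat.mod_eq_of_lt (by omega)]
    omega

/-- The function modulo `p` with mean zero that is `1` where `p ∤ n (n + d)`. -/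
noncomputable def sieveFun (d p n : ℕ) : ℝ :=
  if p ∣ n * (n + d) then -(1 / sieveWeight d p) else 1

theorem sieveFun_periodic (d p : ℕ) : Function.Periodic (sieveFun d p) p := by
  intro n
  have : p ∣ (n + p) * (n + p + d) ↔ p ∣ n * (n + d) := by
    have e : (n + p) * (n + p + d) = n * (n + d) + p * (2 * n + p + d) := by ring
    rw [e]
    exact (Nat.dvd_add_left (Dvd.intro _ rfl))
  simp only [sieveFun, this]

theorem sum_range_ite_dvd {d p : ℕ} (hp : p.Prime) (a : ℝ) :
    ∑ n ∈ Finset.range p, (if p ∣ n * (n + d) then a else 1) =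
      rootCount d p * a + (p - rootCount d p) := by
  have h := Finset.card_filter_add_card_filter_not (s := Finset.range p)
    (fun n => p ∣ n * (n + d))
  rw [card_filter_range_dvd_mul_add hp, Finset.card_range] at h
  have h' : (((Finset.range p).filter fun n => ¬ p ∣ n * (n + d)).card : ℝ) =
      p - rootCount d p := by
    rw [eq_sub_iff_add_eq, add_comm]
    exact_mod_cast h
  rw [Finset.sum_ite, Finset.sum_const, Finset.sum_const, card_filter_range_dvd_mul_add hp,
    nsmul_eq_mul, nsmul_eq_mul, h', mul_one]

theorem sum_range_sieveFun {d p : ℕ} (hp : p.Prime) :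
    ∑ n ∈ Finset.range p, sieveFun d p n = 0 := by
  have h1 : (0 : ℝ) < rootCount d p := by exact_mod_cast rootCount_pos d p
  simp only [sieveFun]
  rw [sum_range_ite_dvd hp, sieveWeight]
  field_simp
  ring

theorem sum_range_sieveFun_sq {d p : ℕ} (hp : p.Prime) :
    ∑ n ∈ Finset.range p, sieveFun d p n ^ 2 = p / sieveWeight d p := by
  have h1 : (0 : ℝ) < rootCount d p := by exact_mod_cast rootCount_pos d p
  simp only [sieveFun, ite_pow, one_pow]
  rw [sum_range_ite_dvd hp, sieveWeight]
  field_simp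
  ring

theorem abs_sieveFun_le {d p : ℕ} (hd : 2 ∣ d) (hp : p.Prime) (n : ℕ) : |sieveFun d p n| ≤ p := by
  have h1 : (1 : ℝ) ≤ rootCount d p := by exact_mod_cast rootCount_pos d p
  have h2 : (rootCount d p : ℝ) < p := by exact_mod_cast rootCount_lt hd hp
  have h3 := sieveWeight_pos hd hp
  rw [sieveFun]
  split_ifs
  · rw [abs_neg, abs_of_pos (by positivity), sieveWeight, one_div_div, div_le_iff₀ (by linarith)]
    nlinarith
  · rw [abs_one]
    linarith

theorem prod_one_add_one_div_le_exp (P : Finset ℕ) {d : ℕ} (hd : d ≠ 0)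
    (hP : ∀ p ∈ P, p.Prime) :
    ∏ p ∈ P with p ∣ d, (1 + 1 / (p : ℝ)) ≤ Real.exp (M d) := by
  rw [M, Real.exp_sum]
  calc ∏ p ∈ P with p ∣ d, (1 + 1 / (p : ℝ)) ≤ ∏ p ∈ P with p ∣ d, Real.exp (1 / (p : ℝ)) := by
        refine Finset.prod_le_prod (fun p _ => by positivity) fun p _ => ?_
        rw [add_comm]
        exact Real.add_one_le_exp _
    _ ≤ ∏ p ∈ d.primeFactors, Real.exp (1 / (p : ℝ)) := by
        refine Finset.prod_le_prod_of_subset_of_one_le (fun p hp => ?_) (fun p _ => by positivity)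
          fun p _ _ => Real.one_le_exp (by positivity)
        rw [Finset.mem_filter] at hp
        exact Nat.mem_primeFactors.2 ⟨hP p hp.1, hp.2, hd⟩

/-! ### Upper bounds for the number of prime pairs -/

theorem G_eq_card (x : ℝ) (d : ℕ) :
    G x d = ((Finset.range (⌊x⌋₊ + 1)).filter fun n =>
      n.Prime ∧ (n + d).Prime ∧ n + d ≤ ⌊x⌋₊).card := by
  refine Finset.card_bij (fun q _ => q.1) ?_ ?_ ?_
  · rintro ⟨a, b⟩ h
    simp only [Finset.mem_filter, Finset.mem_product, Finset.mem_Iic] at h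
    obtain ⟨⟨h1, h2⟩, h3, h4, rfl⟩ := h
    simp only [Finset.mem_filter, Finset.mem_range]
    exact ⟨by omega, h3, h4, h2⟩
  · rintro ⟨a, b⟩ h ⟨a', b'⟩ h' hEq
    simp only [Finset.mem_filter] at h h'
    simp only at hEq
    rw [Prod.mk.injEq]
    exact ⟨hEq, by rw [← h.2.2.2, ← h'.2.2.2, hEq]⟩
  · intro n hn
    simp only [Finset.mem_filter, Finset.mem_range] at hn
    refine ⟨(n, n + d), ?_, rfl⟩
    simp only [Finset.mem_filter, Finset.mem_product, Finset.mem_Iic]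
    exact ⟨⟨by omega, hn.2.2.2⟩, hn.2.1, hn.2.2.1, trivial⟩

theorem G_le_one_of_odd {x : ℝ} {d : ℕ} (hd : ¬ 2 ∣ d) : G x d ≤ 1 := by
  rw [G_eq_card, Finset.card_le_one]
  have key : ∀ n, n.Prime → (n + d).Prime → n = 2 := by
    intro n h1 h2
    rcases h1.eq_two_or_odd with h | h
    · exact h
    · rcases h2.eq_two_or_odd with h' | h'
      · have := h1.two_le
        omega
      · omega
  intro a ha b hb
  rw [Finset.mem_filter] at ha hb
  rw [key a ha.2.1 ha.2.2.1, key b hb.2.1 hb.2.2.1]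

theorem le_of_G_pos {x : ℝ} {d : ℕ} (h : 0 < G x d) : (d : ℝ) ≤ x := by
  rw [G_eq_card, Finset.card_pos] at h
  obtain ⟨n, hn⟩ := h
  rw [Finset.mem_filter] at hn
  have hd0 : n + d ≠ 0 := hn.2.2.1.ne_zero
  have := (Nat.le_floor_iff' hd0).1 hn.2.2.2
  push_cast at this
  have h0 : (0 : ℝ) ≤ n := by positivity
  linarith

/-- The sieve bound for the number of prime pairs with a given even difference. -/
theorem G_le_of_even {x : ℝ} (hx : 0 ≤ x) {d : ℕ} (hd0 : d ≠ 0) (hd : 2 ∣ d) {Y : ℕ}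
    (hY : 2 ≤ Y) :
    (G x d : ℝ) ≤ (Y + 1) + (Y : ℝ) ^ 8 + (x + 1) * (4 * Real.exp (M d) / Real.log Y ^ 2) := by
  set P := Nat.primesLE Y with hPdef
  have hP : ∀ p ∈ P, p.Prime := fun p hp => Nat.prime_of_mem_primesLE hp
  -- The level z = Y² lets J dominate a product of two sums truncated at Y; the sieve error z⁴ is
  -- then Y⁸.
  set J := truncProd (sieveWeight d) P ((Y : ℝ) * Y) with hJ
  have hY2 : (2 : ℝ) ≤ Y := by exact_mod_cast hY
  have hlog : 0 < Real.log Y := Real.log_pos (by linarith)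
  have hJpos : 0 < J := truncProd_pos (fun p hp => (sieveWeight_pos hd (hP p hp)).le) (by nlinarith)
  have hJlow : Real.log Y ^ 2 ≤ 4 * Real.exp (M d) * J := by
    have h1 := log_le_two_mul_truncProd Y
    have h2 := truncProd_mul_truncProd_le hd P hP Y Y (by positivity) (by positivity)
    have h3 : J * ∏ p ∈ P with p ∣ d, (1 + 1 / (p : ℝ)) ≤ J * Real.exp (M d) :=
      mul_le_mul_of_nonneg_left (prod_one_add_one_div_le_exp P hd0 hP) hJpos.le
    nlinarith
  set N := ⌊x⌋₊ + 1 with hN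
  set B := (Finset.range N).filter fun n => n.Prime ∧ (n + d).Prime ∧ n + d ≤ ⌊x⌋₊ with hB
  -- Primes n ≤ Y may be sifted out by themselves, so they are counted trivially by Y + 1.
  set A := B.filter fun n => Y < n with hA
  have hcard : B.card ≤ (Y + 1) + A.card := by
    rw [← Finset.card_filter_add_card_filter_not (s := B) (fun n => Y < n), add_comm]
    refine Nat.add_le_add_right ?_ _
    calc (B.filter fun n => ¬ Y < n).card ≤ (Finset.range (Y + 1)).card := by
          refine Finset.card_le_card fun n hn => ?_
          rw [Finset.mem_filter] at hn
          rw [Finset.mem_range]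
          omega
      _ = Y + 1 := Finset.card_range _
  have hAr : A ⊆ Finset.range N := (Finset.filter_subset _ _).trans (Finset.filter_subset _ _)
  have hA1 : ∀ n ∈ A, ∀ p ∈ P, sieveFun d p n = 1 := by
    intro n hn p hp
    rw [hA, Finset.mem_filter, hB, Finset.mem_filter] at hn
    obtain ⟨⟨-, h1, h2, -⟩, h3⟩ := hn
    have hpY := Nat.le_of_mem_primesLE hp
    rw [sieveFun, if_neg]
    intro h
    rcases (hP p hp).dvd_mul.1 h with h | h
    · have := (Nat.prime_dvd_prime_iff_eq (hP p hp) h1).1 h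
      omega
    · have := (Nat.prime_dvd_prime_iff_eq (hP p hp) h2).1 h
      omega
  have hs := card_sifted_mul_truncProd_le hP (fun p hp => sieveWeight_pos hd (hP p hp))
    (fun p _ => sieveFun_periodic d p) (fun p hp => sum_range_sieveFun (hP p hp))
    (fun p hp => sum_range_sieveFun_sq (hP p hp)) (fun p hp => abs_sieveFun_le hd (hP p hp))
    (z := (Y : ℝ) * Y) (by nlinarith) N hAr hA1
  rw [← hJ] at hs
  have hNx : (N : ℝ) ≤ x + 1 := by
    rw [hN]
    push_cast
    linarith [Nat.floor_le hx]
  have hAle : (A.card : ℝ) ≤ (x + 1) * (4 * Real.exp (M d) / Real.log Y ^ 2) + (Y : ℝ) ^ 8 := by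
    have h1 : ((A.card : ℝ) - (Y : ℝ) ^ 8) * J ≤ x + 1 := by nlinarith
    rw [mul_div_assoc', ← sub_le_iff_le_add, le_div_iff₀ (by positivity)]
    rcases le_or_gt ((A.card : ℝ) - (Y : ℝ) ^ 8) 0 with h | h
    · have : 0 ≤ (x + 1) * (4 * Real.exp (M d)) := by positivity
      nlinarith [sq_nonneg (Real.log Y)]
    · calc ((A.card : ℝ) - (Y : ℝ) ^ 8) * Real.log Y ^ 2
          ≤ ((A.card : ℝ) - (Y : ℝ) ^ 8) * (4 * Real.exp (M d) * J) := by gcongr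
        _ = (((A.card : ℝ) - (Y : ℝ) ^ 8) * J) * (4 * Real.exp (M d)) := by ring
        _ ≤ _ := by gcongr
  rw [G_eq_card, ← hN, ← hB]
  have : (B.card : ℝ) ≤ (Y + 1) + A.card := by exact_mod_cast hcard
  linarith

/-! ### Lower bound for the maximum by pigeonhole modulo a primorial -/

theorem G_le_GStar (x : ℝ) {d : ℕ} (hd : 1 ≤ d) : G x d ≤ GStar x :=
  (isGreatest_GStar x).2 ⟨d, hd, rfl⟩

/-- Cauchy–Schwarz over the φ(q) reduced residue classes. -/
theorem card_sq_le_totient_mul {q : ℕ} (hq : 0 < q) {A : Finset ℕ}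
    (hAq : ∀ p ∈ A, q.Coprime p) :
    A.card ^ 2 ≤ q.totient * ((A ×ˢ A).filter fun c => c.1 % q = c.2 % q).card := by
  set R := (Finset.range q).filter fun a => q.Coprime a with hR
  have hmaps : ∀ p ∈ A, p % q ∈ R := fun p hp => by
    rw [hR, Finset.mem_filter, Finset.mem_range]
    refine ⟨Nat.mod_lt _ hq, ?_⟩
    rw [Nat.coprime_comm, Nat.coprime_iff_gcd_eq_one, ← Nat.gcd_rec]
    exact hAq p hp
  have h1 : A.card = ∑ a ∈ R, (A.filter fun p => p % q = a).card :=
    Finset.card_eq_sum_card_fiberwise hmaps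
  have h2 : ((A ×ˢ A).filter fun c => c.1 % q = c.2 % q).card =
      ∑ a ∈ R, (A.filter fun p => p % q = a).card ^ 2 := by
    rw [Finset.card_eq_sum_card_fiberwise (f := fun c : ℕ × ℕ => c.1 % q) (t := R)]
    · refine Finset.sum_congr rfl fun a _ => ?_
      rw [sq, ← Finset.card_product]
      congr 1
      ext ⟨u, v⟩
      simp only [Finset.mem_filter, Finset.mem_product]
      constructor
      · rintro ⟨⟨⟨hu, hv⟩, h⟩, h'⟩
        exact ⟨⟨hu, h'⟩, hv, h.symm.trans h'⟩
      · rintro ⟨⟨hu, h⟩, hv, h'⟩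
        exact ⟨⟨⟨hu, hv⟩, h.trans h'.symm⟩, h⟩
    · intro c hc
      rw [Finset.mem_coe, Finset.mem_filter, Finset.mem_product] at hc
      exact hmaps _ hc.1.1
  rw [h2, Nat.totient_eq_card_coprime, ← hR]
  conv_lhs => rw [h1]
  exact sq_sum_le_card_mul_sum_sq

/-- The difference of such a pair is q k with 1 ≤ k ≤ ⌊x⌋/q, and each difference occurs at most
`GStar x` times. -/
theorem card_lt_congruent_le {x : ℝ} {q : ℕ} (hq : 0 < q) {A : Finset ℕ}
    (hA : A ⊆ Nat.primesLE ⌊x⌋₊) :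
    ((A ×ˢ A).filter fun c => c.1 < c.2 ∧ c.1 % q = c.2 % q).card ≤ ⌊x⌋₊ / q * GStar x := by
  set N := ⌊x⌋₊ with hN
  have hsub : ((A ×ˢ A).filter fun c => c.1 < c.2 ∧ c.1 % q = c.2 % q) ⊆
      (Finset.Icc 1 (N / q)).biUnion fun k => (Finset.Iic N ×ˢ Finset.Iic N).filter
        fun c : ℕ × ℕ => c.1.Prime ∧ c.2.Prime ∧ c.1 + q * k = c.2 := by
    rintro ⟨u, v⟩ h
    simp only [Finset.mem_filter, Finset.mem_product] at h
    obtain ⟨⟨hu, hv⟩, hlt, hmod⟩ := h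
    have hu' := Nat.mem_primesLE.1 (hA hu)
    have hv' := Nat.mem_primesLE.1 (hA hv)
    obtain ⟨k, hk⟩ := (Nat.modEq_iff_dvd' hlt.le).1 hmod
    simp only [Finset.mem_biUnion, Finset.mem_Icc, Finset.mem_filter, Finset.mem_product,
      Finset.mem_Iic]
    refine ⟨k, ⟨?_, ?_⟩, ⟨hu'.1, hv'.1⟩, hu'.2, hv'.2, by omega⟩
    · rcases Nat.eq_zero_or_pos k with rfl | h0
      · simp only [mul_zero] at hk
        omega
      · exact h0
    · rw [Nat.le_div_iff_mul_le hq, mul_comm]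
      omega
  refine (Finset.card_le_card hsub).trans (Finset.card_biUnion_le.trans ?_)
  calc ∑ k ∈ Finset.Icc 1 (N / q), _ ≤ ∑ k ∈ Finset.Icc 1 (N / q), GStar x := by
        refine Finset.sum_le_sum fun k hk => ?_
        exact G_le_GStar x (Nat.mul_pos hq (Finset.mem_Icc.1 hk).1)
    _ = N / q * GStar x := by simp

/-- Pigeonholing primes into residue classes modulo `q` bounds `GStar` from below. -/
theorem card_sq_le_totient_mul_GStar {x : ℝ} {q : ℕ} (hq : 0 < q) {A : Finset ℕ}
    (hA : A ⊆ Nat.primesLE ⌊x⌋₊) (hAq : ∀ p ∈ A, q.Coprime p) :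
    A.card ^ 2 ≤ q.totient * (A.card + 2 * (⌊x⌋₊ / q * GStar x)) := by
  refine (card_sq_le_totient_mul hq hAq).trans (Nat.mul_le_mul_left _ ?_)
  set L := (A ×ˢ A).filter fun c => c.1 < c.2 ∧ c.1 % q = c.2 % q with hL
  -- Diagonal pairs give the term |A|; the two orderings of the others give the factor 2.
  have hsub : ((A ×ˢ A).filter fun c => c.1 % q = c.2 % q) ⊆
      A.diag ∪ (L ∪ L.image Prod.swap) := by
    rintro ⟨u, v⟩ h
    simp only [Finset.mem_filter, Finset.mem_product] at h
    obtain ⟨⟨hu, hv⟩, hmod⟩ := h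
    rcases lt_trichotomy u v with hlt | rfl | hlt
    · refine Finset.mem_union_right _ (Finset.mem_union_left _ ?_)
      simp only [hL, Finset.mem_filter, Finset.mem_product]
      exact ⟨⟨hu, hv⟩, hlt, hmod⟩
    · exact Finset.mem_union_left _ (Finset.mem_diag.2 ⟨hu, rfl⟩)
    · refine Finset.mem_union_right _ (Finset.mem_union_right _ ?_)
      refine Finset.mem_image.2 ⟨(v, u), ?_, rfl⟩
      simp only [hL, Finset.mem_filter, Finset.mem_product]
      exact ⟨⟨hv, hu⟩, hlt, hmod.symm⟩
  have h1 := card_lt_congruent_le (x := x) hq hA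
  rw [← hL] at h1
  have h2 : (L.image Prod.swap).card ≤ L.card := Finset.card_image_le
  have h3 := Finset.card_union_le A.diag (L ∪ L.image Prod.swap)
  have h4 := Finset.card_union_le L (L.image Prod.swap)
  have h5 := Finset.card_le_card hsub
  rw [Finset.diag_card] at h3
  omega

/-- φ(q)/q is the product of 1 - 1/p over p ≤ m, and its product with that of 1 + 1/p is at most 1.
The latter is at least (log m)/2, since it dominates the truncated sum. -/
theorem totient_primorial_mul_log_le (m : ℕ) :
    ((primorial m).totient : ℝ) * Real.log m ≤ 2 * primorial m := by
  set P := Nat.primesLE m with hP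
  have h1 : ((primorial m).totient : ℝ) = primorial m * ∏ p ∈ P, (1 - 1 / (p : ℝ)) := by
    have := Nat.totient_eq_mul_prod_factors (primorial m)
    rw [primeFactors_primorial] at this
    have h := congrArg (fun t : ℚ => (t : ℝ)) this
    push_cast at h
    simpa [one_div] using h
  have h2 : Real.log m ≤ 2 * ∏ p ∈ P, (1 + 1 / (p : ℝ)) :=
    (log_le_two_mul_truncProd m).trans
      (mul_le_mul_of_nonneg_left (truncProd_le_prod (fun p _ => by positivity) _) (by norm_num))
  have h3 : (∏ p ∈ P, (1 - 1 / (p : ℝ))) * ∏ p ∈ P, (1 + 1 / (p : ℝ)) ≤ 1 := by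
    rw [← Finset.prod_mul_distrib]
    refine Finset.prod_le_one (fun p hp => ?_) fun p hp => ?_
    all_goals
      have hp1 : (1 : ℝ) ≤ p := by exact_mod_cast (Nat.prime_of_mem_primesLE hp).one_lt.le
      have h0 : 1 / (p : ℝ) ≤ 1 := by
        rw [div_le_one (by linarith)]
        exact hp1
      have h0' : (0 : ℝ) ≤ 1 / p := by positivity
      nlinarith
  calc ((primorial m).totient : ℝ) * Real.log m
      ≤ (primorial m).totient * (2 * ∏ p ∈ P, (1 + 1 / (p : ℝ))) := by gcongr
    _ = 2 * primorial m * ((∏ p ∈ P, (1 - 1 / (p : ℝ))) * ∏ p ∈ P, (1 + 1 / (p : ℝ))) := by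
        rw [h1]; ring
    _ ≤ 2 * primorial m * 1 := by gcongr
    _ = 2 * primorial m := mul_one _

theorem GStar_lower_bound {x : ℝ} {m : ℕ} (hx : 0 < x) {a : ℝ} (ha : 0 ≤ a)
    (hma : (m : ℝ) + a ≤ Nat.primeCounting ⌊x⌋₊) (hq : 2 * (primorial m : ℝ) ≤ a) :
    a ^ 2 * Real.log m ≤ 8 * x * GStar x := by
  set q := primorial m with hqdef
  have hqpos : 0 < q := primorial_pos m
  set A := (Nat.primesLE ⌊x⌋₊) \ Nat.primesLE m with hA
  have hAsub : A ⊆ Nat.primesLE ⌊x⌋₊ := Finset.sdiff_subset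
  have hAq : ∀ p ∈ A, q.Coprime p := by
    intro p hp
    rw [hA, Finset.mem_sdiff] at hp
    have hpp := Nat.prime_of_mem_primesLE hp.1
    rw [Nat.coprime_comm, hpp.coprime_iff_not_dvd, hqdef, hpp.dvd_primorial_iff]
    exact fun h => hp.2 (Nat.mem_primesLE.2 ⟨h, hpp⟩)
  have hcardA : a ≤ A.card := by
    have h1 := Finset.le_card_sdiff (Nat.primesLE m) (Nat.primesLE ⌊x⌋₊)
    rw [← hA, Nat.primesLE_card_eq_primeCounting] at h1
    have h2 : (Nat.primesLE m).card ≤ m := by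
      calc (Nat.primesLE m).card ≤ (Finset.Icc 1 m).card := by
            refine Finset.card_le_card fun p hp => ?_
            have := Nat.mem_primesLE.1 hp
            exact Finset.mem_Icc.2 ⟨this.2.one_lt.le, this.1⟩
        _ = m := by simp
    have h3 : Nat.primeCounting ⌊x⌋₊ ≤ A.card + m := by omega
    have h4 : (Nat.primeCounting ⌊x⌋₊ : ℝ) ≤ A.card + m := by exact_mod_cast h3
    linarith
  have hmain := card_sq_le_totient_mul_GStar (x := x) hqpos hAsub hAq
  have hmain' : (A.card : ℝ) ^ 2 ≤
      q.totient * (A.card + 2 * (((⌊x⌋₊ / q : ℕ) : ℝ) * GStar x)) := by exact_mod_cast hmain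
  have hqR : (0 : ℝ) < q := by exact_mod_cast hqpos
  have hdiv : ((⌊x⌋₊ / q : ℕ) : ℝ) ≤ x / q := by
    refine Nat.cast_div_le.trans ?_
    gcongr
    exact Nat.floor_le hx.le
  have htot : (q.totient : ℝ) ≤ q := by exact_mod_cast Nat.totient_le q
  have htl := totient_primorial_mul_log_le m
  rw [← hqdef] at htl
  have hG0 : (0 : ℝ) ≤ GStar x := by positivity
  have h1 : (A.card : ℝ) ^ 2 ≤ 4 * (q.totient * (x / q * GStar x)) := by
    -- Since 2 q ≤ a ≤ |A|, the diagonal is absorbed by half of the left side.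
    have e1 : (q.totient : ℝ) * A.card ≤ A.card ^ 2 / 2 := by
      have : (q.totient : ℝ) ≤ A.card / 2 := by linarith
      nlinarith [(Nat.cast_nonneg A.card : (0 : ℝ) ≤ A.card)]
    have e2 : (q.totient : ℝ) * (((⌊x⌋₊ / q : ℕ) : ℝ) * GStar x) ≤
        q.totient * (x / q * GStar x) := by gcongr
    linarith
  have hlog : 0 ≤ Real.log m := Real.log_natCast_nonneg m
  calc a ^ 2 * Real.log m ≤ (A.card : ℝ) ^ 2 * Real.log m := by gcongr
    _ ≤ 4 * (q.totient * (x / q * GStar x)) * Real.log m := by gcongr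
    _ = 4 * (x / q * GStar x) * (q.totient * Real.log m) := by ring
    _ ≤ 4 * (x / q * GStar x) * (2 * q) := by gcongr
    _ = 8 * x * GStar x := by field_simp; ring

theorem eventually_log_pow_le (k : ℕ) {ε : ℝ} (hε : 0 < ε) :
    ∀ᶠ x : ℝ in atTop, Real.log x ^ k ≤ ε * x := by
  have h := (Real.isLittleO_pow_log_id_atTop (n := k)).bound hε
  filter_upwards [h, eventually_ge_atTop 1] with x hx hx1
  rw [Real.norm_of_nonneg (pow_nonneg (Real.log_nonneg hx1) k),
    Real.norm_of_nonneg (by simp only [id]; linarith)] at hx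
  exact hx

theorem eventually_GStar_ge : ∀ᶠ x : ℝ in atTop,
    x * Real.log (Real.log x) ≤ 256 * Real.log x ^ 2 * GStar x := by
  have hlog := Real.tendsto_log_atTop
  have hsqrt := Real.tendsto_sqrt_atTop
  filter_upwards [eventually_ge_atTop (10 : ℝ), eventually_log_pow_le 2 (ε := 1 / 16) (by norm_num),
    hsqrt.eventually (eventually_log_pow_le 1 (ε := 1 / 16) (by norm_num)),
    hlog.eventually_ge_atTop 36] with x hx10 hlogsq hlogsqrt hlx
  set l := Real.log x with hl
  have hx0 : 0 < x := by linarith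
  -- With m ≤ (log x)/4 the primorial is at most 4^m ≤ e^(2m) ≤ √x, small against x / log x, while
  -- log m still has order log log x.
  set m := ⌊l / 4⌋₊ with hm
  have hm_le : (m : ℝ) ≤ l / 4 := Nat.floor_le (by linarith)
  have hm_ge : l / 4 - 1 ≤ m := (Nat.sub_one_lt_floor _).le
  have hsx : Real.sqrt x * Real.sqrt x = x := Real.mul_self_sqrt hx0.le
  have hsx0 : 0 < Real.sqrt x := Real.sqrt_pos.2 hx0
  rw [pow_one, Real.log_sqrt hx0.le, ← hl] at hlogsqrt
  have hl0 : 0 < l := by linarith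
  have hq : (primorial m : ℝ) ≤ Real.sqrt x := by
    calc (primorial m : ℝ) ≤ (4 : ℝ) ^ m := by exact_mod_cast primorial_le_four_pow m
      _ ≤ (Real.exp 2) ^ m := by
          gcongr
          have := Real.add_one_le_exp (1 : ℝ)
          have h2 : Real.exp 2 = Real.exp 1 * Real.exp 1 := by rw [← Real.exp_add]; norm_num
          nlinarith
      _ = Real.exp (m * 2) := by rw [← Real.exp_nat_mul]
      _ ≤ Real.exp (l / 2) := Real.exp_le_exp.2 (by linarith)
      _ = Real.sqrt x := by
          rw [Real.sqrt_eq_rpow, Real.rpow_def_of_pos hx0, ← hl]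
          congr 1
          ring
  have hpi : (m : ℝ) + x / (4 * l) ≤ Nat.primeCounting ⌊x⌋₊ := by
    refine le_trans ?_ (Chebyshev.pi_ge' (by linarith : 1 < x))
    rw [← hl, le_div_iff₀ hl0]
    have e1 : (↑m + x / (4 * l)) * l = m * l + x / 4 := by field_simp
    have hl2 := Real.log_two_gt_d9
    have h3 : Real.log (x + 2) ≤ 2 * l := by
      rw [hl, ← Real.log_rpow hx0]
      apply Real.log_le_log (by linarith)
      norm_num
      nlinarith
    have e2 : (m : ℝ) * l ≤ l ^ 2 := by nlinarith
    have e3 : 2 * l ≤ l ^ 2 := by nlinarith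
    rw [e1]
    nlinarith
  have hqa : 2 * (primorial m : ℝ) ≤ x / (4 * l) := by
    rw [le_div_iff₀ (by linarith)]
    nlinarith
  have main := GStar_lower_bound hx0 (by positivity) hpi hqa
  have hlm : Real.log l / 2 ≤ Real.log m := by
    rw [← Real.log_sqrt hl0.le]
    apply Real.log_le_log (Real.sqrt_pos.2 hl0)
    refine le_trans ?_ hm_ge
    have h6 : (6 : ℝ) ≤ Real.sqrt l := by
      rw [Real.le_sqrt (by norm_num) hl0.le]
      linarith
    have := Real.mul_self_sqrt hl0.le
    nlinarith
  have h1 : (x / (4 * l)) ^ 2 * (Real.log l / 2) ≤ 8 * x * GStar x :=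
    le_trans (mul_le_mul_of_nonneg_left hlm (by positivity)) main
  have h2 : (x / (4 * l)) ^ 2 * (Real.log l / 2) = x * (x * Real.log l) / (32 * l ^ 2) := by
    field_simp
    ring
  rw [h2, div_le_iff₀ (by positivity)] at h1
  have h3 : x * (x * Real.log l) ≤ x * (256 * l ^ 2 * GStar x) := by linarith
  exact le_of_mul_le_mul_left h3 hx0

/-! ### Mertens' upper bound and the size of `MStar` -/

/-- Finite Euler product: e^t ≤ 1/(1 - t) at each prime, and the expanded product is a subsum of the
zeta series. -/
theorem exp_sum_primes_rpow_le {s : ℝ} (hs : 1 < s) {P : Finset ℕ} (hP : ∀ p ∈ P, p.Prime) :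
    Real.exp (∑ p ∈ P, 1 / (p : ℝ) ^ s) ≤ ∑' n : ℕ, 1 / (n : ℝ) ^ s := by
  set f : ℕ →* ℝ :=
    { toFun := fun n => 1 / (n : ℝ) ^ s
      map_one' := by simp
      map_mul' := fun m n => by
        rw [Nat.cast_mul, Real.mul_rpow (by positivity) (by positivity), one_div_mul_one_div] }
    with hf
  have hfa : ∀ n : ℕ, f n = 1 / (n : ℝ) ^ s := fun _ => rfl
  have hlt : ∀ {p : ℕ}, p.Prime → f p < 1 := fun {p} hp => by
    have hp1 : (1 : ℝ) < p := by exact_mod_cast hp.one_lt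
    rw [hfa, div_lt_one (by positivity)]
    exact Real.one_lt_rpow hp1 (by linarith)
  have hsum : Summable fun n : ℕ => 1 / (n : ℝ) ^ s := Real.summable_one_div_nat_rpow.2 hs
  have h := (EulerProduct.summable_and_hasSum_factoredNumbers_prod_filter_prime_geometric (f := f)
    (fun {p} hp => by
      rw [Real.norm_of_nonneg (by rw [hfa]; positivity)]
      exact hlt hp) P).2
  rw [Finset.filter_true_of_mem hP] at h
  calc Real.exp (∑ p ∈ P, 1 / (p : ℝ) ^ s) = ∏ p ∈ P, Real.exp (f p) := by
        rw [Real.exp_sum]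
        rfl
    _ ≤ ∏ p ∈ P, (1 - f p)⁻¹ := by
        refine Finset.prod_le_prod (fun _ _ => (Real.exp_pos _).le) fun p hp => ?_
        rw [le_inv_comm₀ (Real.exp_pos _) (by linarith [hlt (hP p hp)]), ← Real.exp_neg]
        linarith [Real.add_one_le_exp (-f p)]
    _ = ∑' n : Nat.factoredNumbers P, f n := h.tsum_eq.symm
    _ ≤ ∑' n : ℕ, 1 / (n : ℝ) ^ s :=
        Summable.tsum_subtype_le (fun n : ℕ => 1 / (n : ℝ) ^ s) _ (fun _ => by positivity) hsum

/-- The upper bound in Mertens' second theorem. -/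
theorem eventually_sum_one_div_primes_le {δ : ℝ} (hδ : 0 < δ) : ∀ᶠ y : ℝ in atTop,
    ∑ p ∈ Nat.primesLE ⌊y⌋₊, 1 / (p : ℝ) ≤ (1 + δ) * Real.log (Real.log y) := by
  -- With s = 1 + ε / log y, every p ≤ y has p^(s-1) ≤ e^ε = 1 + δ/2, so passing from exponent s to
  -- 1 costs only this factor.
  set ε := Real.log (1 + δ / 2) with hε
  have hε0 : 0 < ε := Real.log_pos (by linarith)
  have hexp : Real.exp ε = 1 + δ / 2 := Real.exp_log (by linarith)
  have hlog := Real.tendsto_log_atTop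
  have hs : Tendsto (fun y : ℝ => 1 + ε / Real.log y) atTop (nhdsWithin 1 (Set.Ioi 1)) := by
    rw [tendsto_nhdsWithin_iff]
    constructor
    · have := (tendsto_const_nhds (x := ε)).div_atTop hlog
      simpa using this.const_add 1
    · filter_upwards [hlog.eventually_gt_atTop 0] with y hy
      have : 0 < ε / Real.log y := by positivity
      simp only [Set.mem_Ioi]
      linarith
  -- (s - 1) ζ(s) tends to 1 as s decreases to 1, so it is eventually below 2.
  have hz := hs.eventually (tendsto_sub_mul_tsum_nat_rpow.eventually_lt_const
    (by norm_num : (1 : ℝ) < 2))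
  filter_upwards [hz, hlog.eventually_gt_atTop 0,
    (hlog.comp hlog).eventually_ge_atTop ((1 + δ / 2) * Real.log (2 / ε) / (δ / 2)),
    eventually_ge_atTop 1] with y hy hly hlly hy1
  set l := Real.log y with hl
  set s := 1 + ε / l with hsdef
  have hs1 : 1 < s := by
    have : 0 < ε / l := by positivity
    linarith
  have hP : ∀ p ∈ Nat.primesLE ⌊y⌋₊, p.Prime := fun p hp => Nat.prime_of_mem_primesLE hp
  have h1 := exp_sum_primes_rpow_le hs1 hP
  have h2 : ∑' n : ℕ, 1 / (n : ℝ) ^ s ≤ 2 / ε * l := by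
    have : (s - 1) * ∑' n : ℕ, 1 / (n : ℝ) ^ s < 2 := hy
    have e : s - 1 = ε / l := by rw [hsdef]; ring
    rw [e, div_mul_eq_mul_div, div_lt_iff₀ hly] at this
    rw [div_mul_eq_mul_div, le_div_iff₀ hε0]
    linarith
  have h3 : ∑ p ∈ Nat.primesLE ⌊y⌋₊, 1 / (p : ℝ) ^ s ≤ Real.log (2 / ε) + Real.log l := by
    rw [← Real.log_mul (by positivity) hly.ne', Real.le_log_iff_exp_le (by positivity)]
    exact h1.trans h2
  have h4 : ∑ p ∈ Nat.primesLE ⌊y⌋₊, 1 / (p : ℝ) ≤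
      (1 + δ / 2) * ∑ p ∈ Nat.primesLE ⌊y⌋₊, 1 / (p : ℝ) ^ s := by
    rw [Finset.mul_sum]
    refine Finset.sum_le_sum fun p hp => ?_
    have hp0 : (0 : ℝ) < p := by exact_mod_cast (hP p hp).pos
    have hpy : (p : ℝ) ≤ y := (Nat.le_floor_iff (by linarith)).1 (Nat.le_of_mem_primesLE hp)
    have hpl : Real.log p ≤ l := Real.log_le_log hp0 hpy
    have h5 : (p : ℝ) ^ s ≤ p * (1 + δ / 2) := by
      rw [hsdef, Real.rpow_add hp0, Real.rpow_one, ← hexp, Real.rpow_def_of_pos hp0]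
      gcongr
      calc Real.log p * (ε / l) ≤ l * (ε / l) := by gcongr
        _ = ε := by field_simp
    rw [mul_one_div, div_le_div_iff₀ hp0 (by positivity)]
    linarith
  refine h4.trans ?_
  have h6 : (1 + δ / 2) * Real.log (2 / ε) ≤ Real.log l * (δ / 2) :=
    (div_le_iff₀ (by positivity)).1 hlly
  have h7 := mul_le_mul_of_nonneg_left h3 (by linarith : (0 : ℝ) ≤ 1 + δ / 2)
  linarith

theorem two_pow_card_primeFactors_le {d : ℕ} (hd : d ≠ 0) : 2 ^ d.primeFactors.card ≤ d := by
  calc 2 ^ d.primeFactors.card ≤ ∏ p ∈ d.primeFactors, p :=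
        Finset.pow_card_le_prod _ _ _ fun p hp => (Nat.prime_of_mem_primeFactors hp).two_le
    _ ≤ d := Nat.le_of_dvd (Nat.pos_of_ne_zero hd) (Nat.prod_primeFactors_dvd d)

/-- At most log x / log 2 primes divide d, and each one above log x contributes at most 1 / log x;
the total is at most 1 / log 2 < 2. -/
theorem M_le_sum_primes_add_two {x : ℝ} (hx : 1 < x) {d : ℕ} (hd : d ≠ 0) (hdx : (d : ℝ) ≤ x) :
    M d ≤ ∑ p ∈ Nat.primesLE ⌊Real.log x⌋₊, 1 / (p : ℝ) + 2 := by
  have hl : 0 < Real.log x := Real.log_pos hx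
  rw [M, ← Finset.sum_filter_add_sum_filter_not d.primeFactors fun p : ℕ => p ≤ ⌊Real.log x⌋₊]
  refine add_le_add ?_ ?_
  · refine Finset.sum_le_sum_of_subset_of_nonneg (fun p hp => ?_) fun _ _ _ => by positivity
    rw [Finset.mem_filter] at hp
    exact Nat.mem_primesLE.2 ⟨hp.2, Nat.prime_of_mem_primeFactors hp.1⟩
  · have h1 : ∀ p ∈ d.primeFactors.filter fun p : ℕ => ¬ p ≤ ⌊Real.log x⌋₊,
        1 / (p : ℝ) ≤ 1 / Real.log x := fun p hp => by
      rw [Finset.mem_filter, not_le] at hp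
      exact one_div_le_one_div_of_le hl ((Nat.floor_lt hl.le).1 hp.2).le
    refine (Finset.sum_le_card_nsmul _ _ _ h1).trans ?_
    rw [nsmul_eq_mul, mul_one_div, div_le_iff₀ hl]
    have h2 : ((d.primeFactors.filter fun p : ℕ => ¬ p ≤ ⌊Real.log x⌋₊).card : ℝ) ≤
        d.primeFactors.card := by exact_mod_cast Finset.card_filter_le _ _
    have h3 : (2 : ℝ) ^ d.primeFactors.card ≤ x :=
      le_trans (by exact_mod_cast two_pow_card_primeFactors_le hd) hdx
    have h4 := Real.log_le_log (by positivity) h3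
    rw [Real.log_pow] at h4
    have := Real.log_two_gt_d9
    nlinarith

theorem eventually_MStar_le {δ : ℝ} (hδ : 0 < δ) : ∀ᶠ x : ℝ in atTop,
    MStar x ≤ (1 + δ) * Real.log (Real.log (Real.log x)) := by
  have hlog := Real.tendsto_log_atTop
  filter_upwards [hlog.eventually (eventually_sum_one_div_primes_le (half_pos hδ)),
    (hlog.comp (hlog.comp hlog)).eventually_ge_atTop (2 / (δ / 2)), eventually_gt_atTop 1]
    with x h1 h2 hx
  obtain ⟨d, ⟨hd1, hdx⟩, hd⟩ := (isGreatest_MStar hx.le).1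
  rw [← hd]
  have h3 := M_le_sum_primes_add_two hx (by omega) hdx
  have h4 : 2 ≤ Real.log (Real.log (Real.log x)) * (δ / 2) :=
    (div_le_iff₀ (by positivity)).1 h2
  linarith

/-! ### Comparison of the two bounds at a champion -/

theorem M_le_MStar {x : ℝ} {d : ℕ} (hd : 1 ≤ d) (hdx : (d : ℝ) ≤ x) : M d ≤ MStar x :=
  (isGreatest_MStar (le_trans (by exact_mod_cast hd) hdx)).2 ⟨d, ⟨hd, hdx⟩, rfl⟩

/-- A prime difference champion is large enough for the sieve bound to force many small prime
divisors. -/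
theorem exists_eventually_M_ge : ∃ C : ℝ, ∀ᶠ x : ℝ in atTop, ∀ d ∈ DStar x,
    (d : ℝ) ≤ x ∧ Real.log (Real.log (Real.log x)) - C ≤ M d := by
  refine ⟨Real.log (256 * 8195), ?_⟩
  have hlog := Real.tendsto_log_atTop
  have hpow : Tendsto (fun x : ℝ => x ^ (1 / 16 : ℝ)) atTop atTop :=
    tendsto_rpow_atTop (by norm_num)
  have hsqrt := Real.tendsto_sqrt_atTop
  filter_upwards [eventually_GStar_ge, eventually_log_pow_le 2 (ε := 1 / 256) (by norm_num),
    hsqrt.eventually (eventually_log_pow_le 2 (ε := 1 / 4) (by norm_num)),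
    eventually_ge_atTop (1 : ℝ), hpow.eventually_ge_atTop 4, hlog.eventually_gt_atTop 0,
    (hlog.comp hlog).eventually_ge_atTop 2]
    with x hG hlogsq hlogsqrt hx1 hx16 hl0 hll d hd
  have hx0 : 0 < x := by linarith
  obtain ⟨hd1, hdG⟩ := hd
  rw [← hdG] at hG
  set l := Real.log x with hl
  have hll : 2 ≤ Real.log l := hll
  -- More than one pair excludes odd d, which the sieve bound does not cover, and forces d ≤ x.
  have hG1 : (1 : ℝ) < G x d := by
    have h1 : 256 * l ^ 2 * 1 < 256 * l ^ 2 * (G x d : ℝ) := by nlinarith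
    exact lt_of_mul_lt_mul_left h1 (by positivity)
  have hG1' : 1 < G x d := by exact_mod_cast hG1
  refine ⟨le_of_G_pos (by omega), ?_⟩
  have hd2 : 2 ∣ d := by
    by_contra h
    have := G_le_one_of_odd (x := x) h
    omega
  -- The exponent 1/16 makes the sieve error Y⁸ at most √x, while log Y keeps the order of log x.
  set r := x ^ (1 / 16 : ℝ) with hr
  have hr0 : 0 ≤ r := by linarith
  set Y := ⌊r⌋₊ with hY
  have hYr : (Y : ℝ) ≤ r := Nat.floor_le hr0
  have hY4 : 4 ≤ Y := Nat.le_floor (by exact_mod_cast hx16)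
  have hYge : r - 1 ≤ Y := (Nat.sub_one_lt_floor _).le
  have hr8 : r ^ 8 = Real.sqrt x := by
    rw [hr, ← Real.rpow_natCast, ← Real.rpow_mul hx0.le, Real.sqrt_eq_rpow]
    norm_num
  have hlogY : l / 32 ≤ Real.log Y := by
    have h1 : l / 32 = Real.log (Real.sqrt r) := by
      rw [Real.log_sqrt hr0, hr, Real.log_rpow hx0]
      ring
    rw [h1]
    apply Real.log_le_log (Real.sqrt_pos.2 (by linarith))
    have h2 : 2 ≤ Real.sqrt r := by
      rw [Real.le_sqrt (by norm_num) hr0]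
      linarith
    have := Real.mul_self_sqrt hr0
    nlinarith
  have hsieve := G_le_of_even hx0.le (by omega) hd2 (by omega : 2 ≤ Y)
  set E := Real.exp (M d) with hE
  have hM0 : 0 ≤ M d := Finset.sum_nonneg fun _ _ => by positivity
  have hE1 : 1 ≤ E := Real.one_le_exp hM0
  have hr1 : 1 ≤ r := by linarith
  have hb1 : (Y : ℝ) + 1 + (Y : ℝ) ^ 8 ≤ 3 * Real.sqrt x := by
    have h1 : (Y : ℝ) ^ 8 ≤ r ^ 8 := by gcongr
    have h2 : r ≤ r ^ 8 := le_self_pow₀ hr1 (by norm_num)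
    rw [← hr8]
    linarith
  have hb2 : (x + 1) * (4 * E / Real.log Y ^ 2) ≤ 8192 * x * E / l ^ 2 := by
    have h1 : (l / 32) ^ 2 ≤ Real.log Y ^ 2 := by gcongr
    calc (x + 1) * (4 * E / Real.log Y ^ 2) ≤ (2 * x) * (4 * E / (l / 32) ^ 2) := by
          gcongr
          linarith
      _ = 8192 * x * E / l ^ 2 := by field_simp; ring
  have hb3 : l ^ 2 * Real.sqrt x ≤ x := by
    rw [Real.log_sqrt hx0.le, ← hl] at hlogsqrt
    have h1 : l ^ 2 ≤ Real.sqrt x := by nlinarith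
    calc l ^ 2 * Real.sqrt x ≤ Real.sqrt x * Real.sqrt x := by gcongr
      _ = x := Real.mul_self_sqrt hx0.le
  -- 8195 = 8192 + 3: the error 3 √x is absorbed using l² √x ≤ x and E ≥ 1.
  have hb4 : l ^ 2 * (G x d : ℝ) ≤ 8195 * x * E := by
    have h1 : (G x d : ℝ) ≤ 3 * Real.sqrt x + 8192 * x * E / l ^ 2 := by linarith
    calc l ^ 2 * (G x d : ℝ) ≤ l ^ 2 * (3 * Real.sqrt x + 8192 * x * E / l ^ 2) := by gcongr
      _ = 3 * (l ^ 2 * Real.sqrt x) + 8192 * x * E := by field_simp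
      _ ≤ 8195 * x * E := by nlinarith
  have hfin : Real.log l ≤ 256 * 8195 * E := by
    have h1 : x * Real.log l ≤ x * (256 * 8195 * E) := by linarith
    exact le_of_mul_le_mul_left h1 hx0
  have h2 := Real.log_le_log (by linarith) hfin
  rw [Real.log_mul (by norm_num) (by positivity), hE, Real.log_exp] at h2
  linarith

/-- As L tends to infinity, the additive loss C is eventually at most δ L. -/
theorem isEquivalent_of_eventually_bounds {f L : ℝ → ℝ} (hL : Tendsto L atTop atTop) {C : ℝ}
    (hlow : ∀ᶠ x in atTop, L x - C ≤ f x)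
    (hup : ∀ δ > 0, ∀ᶠ x in atTop, f x ≤ (1 + δ) * L x) : f ~[atTop] L := by
  rw [IsEquivalent, isLittleO_iff]
  intro δ hδ
  filter_upwards [hlow, hup δ hδ, hL.eventually_ge_atTop (C / δ), hL.eventually_ge_atTop 0]
    with x h1 h2 h3 h4
  rw [div_le_iff₀ hδ] at h3
  rw [Pi.sub_apply, Real.norm_eq_abs, Real.norm_of_nonneg h4, abs_le]
  constructor <;> linarith

end PrimeDifference

theorem corollary2 (dStar : ℝ → ℕ)
    (hdStar : ∀ᶠ x : ℝ in atTop, dStar x ∈ PrimeDifference.DStar x) :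
    (fun x : ℝ => PrimeDifference.M (dStar x)) ~[atTop] PrimeDifference.MStar ∧
      PrimeDifference.MStar ~[atTop] fun x : ℝ => Real.log (Real.log (Real.log x)) := by
  have hlog := Real.tendsto_log_atTop
  have hL : Tendsto (fun x : ℝ => Real.log (Real.log (Real.log x))) atTop atTop :=
    hlog.comp (hlog.comp hlog)
  obtain ⟨C, hC⟩ := PrimeDifference.exists_eventually_M_ge
  have hlow : ∀ᶠ x : ℝ in atTop,
      Real.log (Real.log (Real.log x)) - C ≤ PrimeDifference.M (dStar x) := by
    filter_upwards [hC, hdStar] with x h1 h2 using (h1 _ h2).2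
  have hle : ∀ᶠ x : ℝ in atTop, PrimeDifference.M (dStar x) ≤ PrimeDifference.MStar x := by
    filter_upwards [hC, hdStar] with x h1 h2
    exact PrimeDifference.M_le_MStar h2.1 (h1 _ h2).1
  have hup : ∀ δ > 0, ∀ᶠ x : ℝ in atTop,
      PrimeDifference.MStar x ≤ (1 + δ) * Real.log (Real.log (Real.log x)) :=
    fun δ hδ => PrimeDifference.eventually_MStar_le hδ
  have h1 := PrimeDifference.isEquivalent_of_eventually_bounds hL hlow
    fun δ hδ => (hle.and (hup δ hδ)).mono fun x h => h.1.trans h.2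
  have h2 := PrimeDifference.isEquivalent_of_eventually_bounds hL
    ((hlow.and hle).mono fun x h => h.1.trans h.2) hup
  exact ⟨h1.trans h2.symm, h2⟩
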